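/- Let $\mathcal A$ be a finite alphabet and let $\Sigma\subset\mathcal A^{\mathbb Z}$ be a subshift, i.e. a closed subset invariant under the shift and its inverse, with $\tau:\Sigma\to\Sigma$, $(\tau x)_i=x_{i+1}$, the restricted shift. Assume that no point of $\Sigma$ is both $\tau$-periodic and isolated in $\Sigma$. Let $\rho(n)$ be the number of words of length $n$ over $\mathcal A$ that appear as blocks of consecutive letters in sequences of $\Sigma$, and suppose that \[\lim_{n\to\infty}\Big(\frac{\log n}{n}\Big)^2\rho(n)=0 .\] Let $[[\tau]]$ be the topological full group of $(\Sigma,\tau)$, i.e. the group of all homeomorphisms $g$ of $\Sigma$ such that every $x\in\Sigma$ has an open neighbourhood $U$ and an integer $k$ with $g|_U=\tau^k|_U$. Let $\mu$ be a finitely supported probability measure on $[[\tau]]$ that is symmetric ($\mu(g^{-1})=\mu(g)$ for all $g$); its support need not generate $[[\tau]]$. Write $\mu^{*n}$ for the $n$-th convolution power of $\mu$ and $H(\nu)=-\sum_g\nu(g)\log\nu(g)$ for the entropy of a probability measure $\nu$. Then the random walk (Avez) entropy of $\mu$ vanishes: \[\lim_{n\to\infty}\frac1n H(\mu^{*n})=0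 .\] More precisely, there exists a constant $C>0$ (which may depend on $\Sigma$ and $\mu$) such that for every $n\ge 2$ \[H(\mu^{*n})\le C\,\rho\big(\lceil C\sqrt{n\log n}\,\rceil\big)\log n .\] -/

import Mathlib

open Filter Topology
open scoped ENNReal

/-! ## Subshifts, complexity, topological full groups -/

/-- The shift `(τ x)_h = x_{1 + h}` as a homeomorphism of a two-sided subshift. -/
def SymbolicDynamics.FullShift.Subshift.shiftHomeo {A : Type*} [TopologicalSpace A]
    (Y : SymbolicDynamics.FullShift.Subshift A ℤ) : Y.carrier ≃ₜ Y.carrier where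
  toFun x := ⟨SymbolicDynamics.FullShift.shift (1 : ℤ) x.1, Y.mapsTo 1 x.2⟩
  invFun x := ⟨SymbolicDynamics.FullShift.shift (-1 : ℤ) x.1, Y.mapsTo (-1) x.2⟩
  left_inv x := by
    ext h
    simp [SymbolicDynamics.FullShift.shift]
  right_inv x := by
    ext h
    simp [SymbolicDynamics.FullShift.shift]
  continuous_toFun := by
    refine Continuous.subtype_mk ?_ _
    exact (SymbolicDynamics.FullShift.continuous_shift 1).comp continuous_subtype_val
  continuous_invFun := by
    refine Continuous.subtype_mk ?_ _
    exact (SymbolicDynamics.FullShift.continuous_shift (-1)).comp continuous_subtype_val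

/-- The word `w` of length `n` appears as a block of consecutive letters in some sequence of `Y`. -/
def SymbolicDynamics.FullShift.Subshift.IsWord {A : Type*} [TopologicalSpace A]
    (Y : SymbolicDynamics.FullShift.Subshift A ℤ) {n : ℕ} (w : Fin n → A) : Prop :=
  ∃ x ∈ Y.carrier, ∃ i : ℤ, ∀ j : Fin n, w j = x (i + (j : ℤ))

/-- The complexity `ρ(n)`: the number of words of length `n` that appear in `Y`
(a finite number when the alphabet is finite). -/
noncomputable def SymbolicDynamics.FullShift.Subshift.complexity {A : Type*} [TopologicalSpace A]
    (Y : SymbolicDynamics.FullShift.Subshift A ℤ) (n : ℕ) : ℕ :=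
  Set.ncard {w : Fin n → A | Y.IsWord w}

/-- The topological full group `[[τ]]`: all homeomorphisms that coincide, in a neighbourhood of
each point, with some power `τ ^ k`, `k ∈ ℤ`. Multiplication is composition. -/
def Homeomorph.topologicalFullGroup {X : Type*} [TopologicalSpace X] (τ : X ≃ₜ X) :
    Subgroup (X ≃ₜ X) where
  carrier := {g | ∀ x, ∃ U : Set X, IsOpen U ∧ x ∈ U ∧ ∃ k : ℤ, ∀ y ∈ U, g y = (τ ^ k) y}
  one_mem' := fun _ => ⟨_root_.Set.univ, isOpen_univ, trivial, 0, fun _ _ => by simp⟩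
  mul_mem' := by
    intro a b ha hb x
    obtain ⟨U, hU, hxU, k, hk⟩ := hb x
    obtain ⟨V, hV, hxV, l, hl⟩ := ha (b x)
    refine ⟨U ∩ b ⁻¹' V, hU.inter (hV.preimage b.continuous), ⟨hxU, hxV⟩, l + k, ?_⟩
    rintro y ⟨hyU, hyV⟩
    have h1 : (a * b) y = a (b y) := rfl
    have h2 : (τ ^ l * τ ^ k) y = (τ ^ l) ((τ ^ k) y) := rfl
    rw [h1, zpow_add, h2, hl _ hyV, hk _ hyU]
  inv_mem' := by
    intro a ha x
    obtain ⟨U, hU, hxU, k, hk⟩ := ha (a⁻¹ x)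
    refine ⟨(a⁻¹ : X ≃ₜ X) ⁻¹' U, hU.preimage (a⁻¹ : X ≃ₜ X).continuous, hxU, -k, ?_⟩
    intro y hy
    have h1 : y = (τ ^ k) (a⁻¹ y) := by
      rw [← hk _ hy]
      exact (a.apply_symm_apply y).symm
    have h2 : (τ ^ (-k)) ((τ ^ k) (a⁻¹ y)) = a⁻¹ y := by
      rw [zpow_neg]
      exact (τ ^ k).symm_apply_apply _
    rw [← h1] at h2
    exact h2.symm

/-! ## Convolution powers and entropy of probability measures on a (discrete) group -/

/-- The `n`-th convolution power `μ^{*n}`: the law of a product of `n` independent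
random elements with law `μ`. -/
noncomputable def PMF.convPow {G : Type*} [Group G] (μ : PMF G) : ℕ → PMF G
  | 0 => PMF.pure 1
  | n + 1 => (PMF.convPow μ n).bind fun g => μ.map fun h => g * h

/-- The entropy `H(ν) = - ∑ ν(g) log ν(g) ∈ [0, ∞]`. -/
noncomputable def PMF.entropy {G : Type*} (ν : PMF G) : ℝ≥0∞ :=
  ∑' g, ENNReal.ofReal (Real.negMulLog (ν g).toReal)

/-- The random walk entropy (Avez entropy) `lim H(μ^{*n}) / n` exists and equals `h`. -/
def PMF.HasRandomWalkEntropy {G : Type*} [Group G] (μ : PMF G) (h : ℝ≥0∞) : Prop :=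
  Tendsto (fun n : ℕ => (μ.convPow n).entropy / (n : ℝ≥0∞)) atTop (𝓝 h)

/-! Since `τ` is topologically free, `g` acts near `x` as a unique power of `τ`, whose exponent is
`cocycle g x`, and `g` is determined by its cocycle. Identifying ℤ with the orbit of `x` makes the
group act on ℤ with `0 ↦ cocycle g x`, so the cocycle at `x` of a random product is a symmetric walk
on ℤ with jumps at most `R`. A Varopoulos-Carne bound (`toOuterMeasure_convPow_displacement_le`)
shows that after `n` steps it exceeds `m ≈ 4R √(n log n)` only with a probability that is a high
negative power of `n`.

If all right factors of a product keep their displacement at most `m`, and the generators read only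
the window `[-r, r]`, then by induction the product reads only `[-(m+r), m+r]`: the next letter
looks `r` places around a point displaced by at most `m`, so the window never grows
(`avoidingProducts_subset_localElements`). Hence displacements need controlling at only one point
for each word of length `2(m+r)+1`. The hypothesis makes `ρ` at most quadratic, so a union bound
over words and times still gives a small probability.

The good products number at most `(2m+1)^ρ(2(m+r)+1)`, whose logarithm is the main term. The bad
ones contribute their probability times the logarithm of the support size, which is `O(n)`. Taking
`m` of order `√(n log n)` gives the estimate, and the hypothesis on `ρ` makes it `o(n)`. -/

/-! ## The discrete wave equation and Gaussian bounds -/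

section WaveEquation

variable {E : Type*} [NormedAddCommGroup E] [InnerProductSpace ℝ E]

/-- The solution at time `k` of the discrete wave equation `u (k+1) + u (k-1) = 2 P (u k)`
with initial data `u 0 = v`, `u 1 = P v`. -/
noncomputable def waveEvolution (P : Module.End ℝ E) (v : E) (k : ℤ) : E :=
  Polynomial.aeval P (Polynomial.Chebyshev.T ℝ k) v

lemma waveEvolution_zero (P : Module.End ℝ E) (v : E) : waveEvolution P v 0 = v := by
  simp [waveEvolution]

lemma waveEvolution_one (P : Module.End ℝ E) (v : E) : waveEvolution P v 1 = P v := by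
  simp [waveEvolution]

lemma waveEvolution_neg (P : Module.End ℝ E) (v : E) (k : ℤ) :
    waveEvolution P v (-k) = waveEvolution P v k := by
  simp [waveEvolution]

lemma waveEvolution_natAbs (P : Module.End ℝ E) (v : E) (k : ℤ) :
    waveEvolution P v (k.natAbs : ℤ) = waveEvolution P v k := by
  rcases Int.natAbs_eq k with h | h
  · rw [← h]
  · rw [← waveEvolution_neg, ← h]

lemma waveEvolution_add_two (P : Module.End ℝ E) (v : E) (k : ℤ) :
    waveEvolution P v (k + 2) = (2 : ℝ) • P (waveEvolution P v (k + 1)) - waveEvolution P v k := by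
  simp only [waveEvolution, Polynomial.Chebyshev.T_add_two, map_sub, map_mul, Polynomial.aeval_X,
    LinearMap.sub_apply, Module.End.mul_apply, map_ofNat, ofNat_smul_eq_nsmul]
  rfl

/-- Conservation of energy, from the recurrence and the symmetry of `P`. For a contraction `P` it
bounds `u (k+1) - P (u k)` by `‖v‖` at every time. -/
lemma waveEvolution_energy {P : Module.End ℝ E} (hP : P.IsSymmetric) (v : E) (k : ℕ) :
    ‖waveEvolution P v (k + 1) - P (waveEvolution P v k)‖ ^ 2 + ‖waveEvolution P v k‖ ^ 2
      - ‖P (waveEvolution P v k)‖ ^ 2 = ‖v‖ ^ 2 - ‖P v‖ ^ 2 := by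
  induction k with
  | zero => simp [waveEvolution_zero, waveEvolution_one]
  | succ k ih =>
    rw [← ih]
    push_cast
    rw [show (k : ℤ) + 1 + 1 = k + 2 by ring, waveEvolution_add_two]
    set a := waveEvolution P v k
    set b := waveEvolution P v (k + 1)
    have h1 : (2 : ℝ) • P b - a - P b = P b - a := by rw [two_smul]; abel
    rw [h1, norm_sub_sq_real, norm_sub_sq_real, hP b a]
    ring

/-- The energy bounds each increment, so the wave grows at most linearly. The spectral theorem would
remove the factor `k + 1`, but a polynomial loss is harmless here. -/
lemma norm_waveEvolution_natCast_le {P : Module.End ℝ E} (hP : P.IsSymmetric)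
    (hc : ∀ v, ‖P v‖ ≤ ‖v‖) (v : E) (k : ℕ) :
    ‖waveEvolution P v k‖ ≤ (k + 1) * ‖v‖ := by
  induction k with
  | zero => simp [waveEvolution_zero]
  | succ k ih =>
    have he := waveEvolution_energy hP v k
    have h1 : ‖waveEvolution P v (k + 1) - P (waveEvolution P v k)‖ ≤ ‖v‖ := by
      have h2 := hc (waveEvolution P v k)
      have h3 : ‖P (waveEvolution P v k)‖ ^ 2 ≤ ‖waveEvolution P v k‖ ^ 2 := by gcongr
      have h4 : 0 ≤ ‖P v‖ ^ 2 := by positivity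
      exact (sq_le_sq₀ (norm_nonneg _) (norm_nonneg _)).1 (by linarith)
    have h5 : ‖waveEvolution P v (k + 1)‖ ≤
        ‖waveEvolution P v (k + 1) - P (waveEvolution P v k)‖ + ‖P (waveEvolution P v k)‖ := by
      simpa using norm_add_le (waveEvolution P v (k + 1) - P (waveEvolution P v k))
        (P (waveEvolution P v k))
    push_cast
    linarith [hc (waveEvolution P v k)]

lemma norm_waveEvolution_le {P : Module.End ℝ E} (hP : P.IsSymmetric)
    (hc : ∀ v, ‖P v‖ ≤ ‖v‖) (v : E) (k : ℤ) :
    ‖waveEvolution P v k‖ ≤ (|(k : ℝ)| + 1) * ‖v‖ := by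
  have := norm_waveEvolution_natCast_le hP hc v k.natAbs
  rwa [waveEvolution_natAbs, Nat.cast_natAbs, Int.cast_abs] at this

lemma map_waveEvolution (P : Module.End ℝ E) (v : E) (k : ℤ) :
    P (waveEvolution P v k) =
      (1 / 2 : ℝ) • (waveEvolution P v (k + 1) + waveEvolution P v (k - 1)) := by
  have h := waveEvolution_add_two P v (k - 1)
  rw [show k - 1 + 2 = k + 1 by ring, show k - 1 + 1 = k by ring] at h
  rw [h, sub_add_cancel, smul_smul]
  norm_num

/-- If a functional `φ` is bounded by `K cosh (t k)` along a wave, then it is bounded by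
`K cosh (t) ^ n cosh (t k)` along its image under `P ^ n`. -/
lemma abs_pow_waveEvolution_le (P : Module.End ℝ E) (v : E) (φ : E →ₗ[ℝ] ℝ) (N : ℕ) (K t : ℝ)
    (h : ∀ k : ℤ, k.natAbs ≤ N → |φ (waveEvolution P v k)| ≤ K * Real.cosh (t * k)) (n : ℕ) :
    ∀ k : ℤ, k.natAbs + n ≤ N →
      |φ ((P ^ n) (waveEvolution P v k))| ≤ K * Real.cosh t ^ n * Real.cosh (t * k) := by
  induction n with
  | zero => intro k hk; simpa using h k (by omega)
  | succ n ih =>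
    intro k hk
    rw [pow_succ, Module.End.mul_apply, map_waveEvolution, map_smul, map_smul, map_add, map_add,
      smul_eq_mul, abs_mul]
    have h1 := ih (k + 1) (by omega)
    have h2 := ih (k - 1) (by omega)
    have h3 := abs_add_le (φ ((P ^ n) (waveEvolution P v (k + 1))))
      (φ ((P ^ n) (waveEvolution P v (k - 1))))
    -- `cosh (t k)` is an eigenfunction, with eigenvalue `cosh t`, of the averaging over `k ± 1` by
    -- which `P` acts on waves.
    have h4 : Real.cosh (t * (k + 1 : ℤ)) + Real.cosh (t * (k - 1 : ℤ))
        = 2 * Real.cosh t * Real.cosh (t * k) := by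
      push_cast
      rw [mul_add, mul_sub, mul_one, Real.cosh_add, Real.cosh_sub]
      ring
    have h5 : |(1 / 2 : ℝ)| = 1 / 2 := abs_of_pos (by norm_num)
    rw [h5]
    calc _ ≤ 1 / 2 * (K * Real.cosh t ^ n * (Real.cosh (t * (k + 1 : ℤ))
            + Real.cosh (t * (k - 1 : ℤ)))) := by linarith
      _ = _ := by rw [h4]; ring

/-- A form of the Varopoulos-Carne bound: if waves started at `v` are not seen by `φ` before
time `d`, then `φ (P ^ n v)` is Gaussian small. -/
lemma abs_pow_apply_le {P : Module.End ℝ E} (hP : P.IsSymmetric) (hc : ∀ v, ‖P v‖ ≤ ‖v‖) (v : E)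
    (φ : E →ₗ[ℝ] ℝ) (hφ : ∀ w, |φ w| ≤ ‖w‖) (d : ℝ) (hd0 : 0 ≤ d)
    (hd : ∀ k : ℤ, |(k : ℝ)| ≤ d → φ (waveEvolution P v k) = 0) (n : ℕ) (hn : n ≠ 0) :
    |φ ((P ^ n) v)| ≤ 2 * (n + 1) * ‖v‖ * Real.exp (-(d ^ 2 / (2 * n))) := by
  have hn' : (0 : ℝ) < n := by positivity
  -- The minimizer of `n t² / 2 - t d`.
  set t : ℝ := d / n
  have ht0 : 0 ≤ t := by positivity
  have key := abs_pow_waveEvolution_le P v φ n (2 * (n + 1) * ‖v‖ * Real.exp (-(t * d))) t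
    (fun k hk => ?_) n 0 (by simp)
  · rw [waveEvolution_zero] at key
    refine key.trans ?_
    have h1 : Real.cosh t ^ n ≤ Real.exp (n * (t ^ 2 / 2)) := by
      rw [Real.exp_nat_mul]
      gcongr
      exact Real.cosh_le_exp_half_sq t
    calc _ ≤ 2 * (n + 1) * ‖v‖ * Real.exp (-(t * d)) * Real.exp (n * (t ^ 2 / 2)) := by
            simp only [Int.cast_zero, mul_zero, Real.cosh_zero, mul_one]
            gcongr
      _ = _ := by
        rw [mul_assoc, ← Real.exp_add]
        congr 2
        simp only [t]
        field_simp
        ring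
  · by_cases hkd : |(k : ℝ)| ≤ d
    · rw [hd k hkd, abs_zero]
      have := Real.cosh_pos (t * k)
      positivity
    · push Not at hkd
      have hkn : |(k : ℝ)| ≤ n := by
        rw [← Int.cast_abs, ← Nat.cast_natAbs]
        exact_mod_cast hk
      have h1 : Real.exp (t * d) ≤ 2 * Real.cosh (t * k) := by
        rw [← Real.cosh_abs, abs_mul, abs_of_nonneg ht0, Real.cosh_eq]
        have : Real.exp (t * d) ≤ Real.exp (t * |(k : ℝ)|) := by gcongr
        linarith [Real.exp_pos (-(t * |(k : ℝ)|))]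
      have h2 : 1 ≤ Real.exp (-(t * d)) * (2 * Real.cosh (t * k)) := by
        calc 1 = Real.exp (-(t * d)) * Real.exp (t * d) := by rw [← Real.exp_add]; simp
          _ ≤ _ := by gcongr
      calc _ ≤ ‖waveEvolution P v k‖ := hφ _
        _ ≤ (|(k : ℝ)| + 1) * ‖v‖ := norm_waveEvolution_le hP hc v k
        _ ≤ (n + 1) * ‖v‖ * 1 := by rw [mul_one]; gcongr
        _ ≤ (n + 1) * ‖v‖ * (Real.exp (-(t * d)) * (2 * Real.cosh (t * k))) := by gcongr
        _ = _ := by ring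

end WaveEquation

/-! ### Markov operators on `ℓ²` of a group acting by permutations -/

section PermutationOperators

variable {ι : Type*}

/-- The `i`-th coordinate as a linear functional on `ℓ²`. -/
noncomputable def lpEval (i : ι) : lp (fun _ : ι => ℝ) 2 →ₗ[ℝ] ℝ where
  toFun v := v i
  map_add' _ _ := rfl
  map_smul' _ _ := rfl

/-- Composition with a permutation as an operator on `ℓ²`. -/
noncomputable def lpPerm (e : Equiv.Perm ι) : Module.End ℝ (lp (fun _ : ι => ℝ) 2) where
  toFun v := ⟨fun i => v (e i), (memℓp_gen_iff (by norm_num)).2 <|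
    (e.summable_iff (f := fun i => ‖v i‖ ^ (2 : ℝ≥0∞).toReal)).2 <|
      (memℓp_gen_iff (by norm_num)).1 (lp.memℓp v)⟩
  map_add' _ _ := rfl
  map_smul' _ _ := rfl

lemma lpPerm_apply (e : Equiv.Perm ι) (v : lp (fun _ : ι => ℝ) 2) (i : ι) :
    lpPerm e v i = v (e i) := rfl

lemma norm_lpPerm (e : Equiv.Perm ι) (v : lp (fun _ : ι => ℝ) 2) : ‖lpPerm e v‖ = ‖v‖ := by
  rw [lp.norm_eq_tsum_rpow (by norm_num), lp.norm_eq_tsum_rpow (by norm_num)]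
  congr 1
  exact e.tsum_eq (fun i => ‖v i‖ ^ (2 : ℝ≥0∞).toReal)

lemma inner_lpPerm_left (e : Equiv.Perm ι) (v w : lp (fun _ : ι => ℝ) 2) :
    inner ℝ (lpPerm e v) w = inner ℝ v (lpPerm e⁻¹ w) := by
  rw [lp.inner_eq_tsum, lp.inner_eq_tsum, ← e.tsum_eq (fun i => inner ℝ (v i) _)]
  simp [lpPerm_apply]

variable {G : Type*} [Group G]

/-- The Markov operator of the random walk with step weights `w` supported on `S` induced by an
action of `G` on `ι`. -/
noncomputable def markovOperator (σ : G →* Equiv.Perm ι) (S : Finset G) (w : G → ℝ) :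
    Module.End ℝ (lp (fun _ : ι => ℝ) 2) :=
  ∑ h ∈ S, w h • lpPerm (σ h)

lemma markovOperator_apply (σ : G →* Equiv.Perm ι) (S : Finset G) (w : G → ℝ)
    (v : lp (fun _ : ι => ℝ) 2) (i : ι) :
    markovOperator σ S w v i = ∑ h ∈ S, w h * v (σ h i) := by
  change lpEval i _ = _
  rw [markovOperator, LinearMap.sum_apply, map_sum]
  rfl

lemma markovOperator_isSymmetric (σ : G →* Equiv.Perm ι) {S : Finset G} {w : G → ℝ}
    (hS : ∀ h ∈ S, h⁻¹ ∈ S) (hw : ∀ h, w h⁻¹ = w h) : (markovOperator σ S w).IsSymmetric := by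
  intro a b
  simp only [markovOperator, LinearMap.sum_apply, sum_inner, inner_sum, LinearMap.smul_apply,
    real_inner_smul_left, real_inner_smul_right, inner_lpPerm_left]
  refine Finset.sum_bij' (fun h _ => h⁻¹) (fun h _ => h⁻¹) hS hS (by simp) (by simp) ?_
  intro h _
  rw [hw, map_inv]

lemma norm_markovOperator_apply_le (σ : G →* Equiv.Perm ι) {S : Finset G} {w : G → ℝ}
    (hw0 : ∀ h, 0 ≤ w h) (hw1 : ∑ h ∈ S, w h ≤ 1) (v : lp (fun _ : ι => ℝ) 2) :
    ‖markovOperator σ S w v‖ ≤ ‖v‖ := by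
  rw [markovOperator, LinearMap.sum_apply]
  calc _ ≤ ∑ h ∈ S, ‖(w h • lpPerm (σ h)) v‖ := norm_sum_le _ _
    _ = (∑ h ∈ S, w h) * ‖v‖ := by
      rw [Finset.sum_mul]
      refine Finset.sum_congr rfl fun h _ => ?_
      rw [LinearMap.smul_apply, norm_smul, norm_lpPerm, Real.norm_of_nonneg (hw0 h)]
    _ ≤ 1 * ‖v‖ := by gcongr
    _ = _ := one_mul _

/-- Finite speed of propagation. -/
lemma waveEvolution_markovOperator_eq_zero (σ : G →* Equiv.Perm ℤ) (S : Finset G) (w : G → ℝ)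
    (R : ℕ) (hR : ∀ h ∈ S, ∀ i, |σ h i - i| ≤ R) (v : lp (fun _ : ℤ => ℝ) 2) (d : ℕ)
    (hv : ∀ i : ℤ, |i| ≤ d → v i = 0) (k : ℕ) :
    ∀ i : ℤ, |i| + R * k ≤ d → waveEvolution (markovOperator σ S w) v k i = 0 := by
  have step : ∀ u : lp (fun _ : ℤ => ℝ) 2, ∀ k : ℕ, (∀ i : ℤ, |i| + R * k ≤ d → u i = 0) →
      ∀ i : ℤ, |i| + R * (k + 1 : ℕ) ≤ d → markovOperator σ S w u i = 0 := by
    intro u k hu i hi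
    rw [markovOperator_apply]
    refine Finset.sum_eq_zero fun h hh => ?_
    rw [hu, mul_zero]
    have h1 := hR h hh i
    have h2 : |σ h i| ≤ |σ h i - i| + |i| := by simpa using abs_add_le (σ h i - i) i
    push_cast at hi
    linarith
  induction k using Nat.twoStepInduction with
  | zero => intro i hi; rw [Nat.cast_zero, waveEvolution_zero]; exact hv i (by simpa using hi)
  | one =>
    rw [Nat.cast_one, waveEvolution_one]
    exact fun i hi => step v 0 (fun i hi => hv i (by simpa using hi)) i hi
  | more k ih0 ih1 =>
    intro i hi
    have h1 := step _ (k + 1) ih1 i hi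
    have h2 := ih0 i (by push_cast at hi; nlinarith [Int.natCast_nonneg R])
    push_cast at h1 ⊢
    rw [waveEvolution_add_two]
    change (2 : ℝ) * _ - _ = 0
    rw [h1, h2, mul_zero, sub_zero]

/-- The indicator function of a finite set as an element of `ℓ²`. -/
noncomputable def lpIndicator [DecidableEq ι] (T : Finset ι) : lp (fun _ : ι => ℝ) 2 :=
  ∑ i ∈ T, lp.single 2 i (1 : ℝ)

lemma lpIndicator_apply [DecidableEq ι] (T : Finset ι) (i : ι) :
    lpIndicator T i = if i ∈ T then 1 else 0 := by
  change lpEval i _ = _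
  rw [lpIndicator, map_sum]
  change ∑ j ∈ T, lp.single 2 j (1 : ℝ) i = _
  simp [Pi.single_apply]

lemma norm_lpIndicator_le [DecidableEq ι] (T : Finset ι) : ‖lpIndicator T‖ ≤ T.card := by
  refine (norm_sum_le _ _).trans ?_
  simp [lp.norm_single]

lemma markovOperator_pow_lpIndicator_le (σ : G →* Equiv.Perm ℤ) {S : Finset G} {w : G → ℝ}
    (hS : ∀ h ∈ S, h⁻¹ ∈ S) (hw : ∀ h, w h⁻¹ = w h) (hw0 : ∀ h, 0 ≤ w h)
    (hw1 : ∑ h ∈ S, w h ≤ 1) (R : ℕ) (hR0 : R ≠ 0) (hR : ∀ h ∈ S, ∀ i, |σ h i - i| ≤ R)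
    (T : Finset ℤ) (m : ℕ) (hT : ∀ i ∈ T, m < |i|) (n : ℕ) (hn : n ≠ 0) :
    ((markovOperator σ S w) ^ n) (lpIndicator T) 0 ≤
      2 * (n + 1) * T.card * Real.exp (-(m ^ 2 / (2 * R ^ 2 * n))) := by
  have h := abs_pow_apply_le (markovOperator_isSymmetric σ hS hw)
    (norm_markovOperator_apply_le σ hw0 hw1) (lpIndicator T)
    (lpEval 0) (fun v => lp.norm_apply_le_norm (by norm_num) v 0)
    -- Waves travel at speed at most `R`, so one starting outside `[-m, m]` is not seen at `0` up to
    -- time `m / R`.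
    (m / R) (by positivity) ?_ n hn
  · refine (le_abs_self _).trans (h.trans ?_)
    have : ((m : ℝ) / R) ^ 2 / (2 * n) = m ^ 2 / (2 * R ^ 2 * n) := by
      field_simp
    rw [this]
    gcongr
    exact norm_lpIndicator_le T
  · intro k hk
    rw [← waveEvolution_natAbs]
    refine waveEvolution_markovOperator_eq_zero σ S w R hR _ m (fun i hi => ?_) _ 0 ?_
    · rw [lpIndicator_apply, if_neg]
      exact fun hi' => absurd (hT i hi') (not_lt.2 hi)
    · rw [le_div_iff₀ (by positivity), ← Int.cast_abs, ← Nat.cast_natAbs] at hk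
      rw [abs_zero, zero_add, mul_comm]
      exact_mod_cast hk

end PermutationOperators

/-! ## Convolution powers -/

namespace PMF

variable {G : Type*} [Group G]

lemma toOuterMeasure_ne_top {α : Type*} (p : PMF α) (s : Set α) : p.toOuterMeasure s ≠ ∞ := by
  rw [toOuterMeasure_apply]
  exact p.tsum_coe_indicator_ne_top s

lemma convPow_succ_eq_bind_map_mul_right (μ : PMF G) (n : ℕ) :
    μ.convPow (n + 1) = μ.bind fun h => (μ.convPow n).map fun g => g * h := by
  simp only [convPow, ← bind_pure_comp]
  rw [bind_comm]
  rfl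

/-- Under the action the rightmost factor moves first. Markov operators peel that factor off, while
the induction on right factors peels off the leftmost one. -/
lemma convPow_succ_eq_bind_map_mul_left (μ : PMF G) (n : ℕ) :
    μ.convPow (n + 1) = μ.bind fun h => (μ.convPow n).map fun g => h * g := by
  induction n with
  | zero =>
    simp only [convPow, pure_map, pure_bind, one_mul, mul_one]
    rw [show (fun h : G => h) = id from rfl, map_id]
    exact (bind_pure μ).symm
  | succ n ih =>
    rw [convPow_succ_eq_bind_map_mul_right μ (n + 1)]
    conv_lhs => rw [ih]
    conv_rhs => rw [convPow_succ_eq_bind_map_mul_right μ n]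
    simp only [map_bind, map_comp]
    rw [bind_comm]
    congr 1
    ext1 a
    congr 1
    ext1 b
    congr 1
    ext1 g
    simp [mul_assoc]

lemma toOuterMeasure_convPow_succ (μ : PMF G) (n : ℕ) (s : Set G) :
    (μ.convPow (n + 1)).toOuterMeasure s =
      ∑' h, μ h * (μ.convPow n).toOuterMeasure ((fun g => g * h) ⁻¹' s) := by
  rw [convPow_succ_eq_bind_map_mul_right, toOuterMeasure_bind_apply]
  simp only [toOuterMeasure_map_apply]

lemma toOuterMeasure_convPow_succ' (μ : PMF G) (n : ℕ) (s : Set G) :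
    (μ.convPow (n + 1)).toOuterMeasure s =
      ∑' h, μ h * (μ.convPow n).toOuterMeasure ((fun g => h * g) ⁻¹' s) := by
  rw [convPow_succ_eq_bind_map_mul_left, toOuterMeasure_bind_apply]
  simp only [toOuterMeasure_map_apply]

lemma exists_finset_support_convPow (μ : PMF G) (hfin : μ.support.Finite) (n : ℕ) :
    ∃ T : Finset G, (μ.convPow n).support ⊆ T ∧ T.card ≤ hfin.toFinset.card ^ n := by
  classical
  induction n with
  | zero => exact ⟨{1}, by simp [convPow], by simp⟩
  | succ n ih =>
    obtain ⟨T, hT, hc⟩ := ih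
    refine ⟨Finset.image₂ (· * ·) T hfin.toFinset, fun g hg => ?_, ?_⟩
    · simp only [convPow, mem_support_bind_iff, mem_support_map_iff] at hg
      obtain ⟨a, ha, b, hb, rfl⟩ := hg
      exact Finset.mem_coe.2 (Finset.mem_image₂_of_mem (hT ha) (hfin.mem_toFinset.2 hb))
    · refine (Finset.card_image₂_le _ _ _).trans ?_
      rw [pow_succ]
      gcongr

lemma sum_toReal_apply_le_one {α : Type*} (μ : PMF α) (s : Finset α) :
    ∑ h ∈ s, (μ h).toReal ≤ 1 := by
  rw [← ENNReal.toReal_sum fun a _ => μ.apply_ne_top a]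
  refine ENNReal.toReal_le_of_le_ofReal zero_le_one ?_
  rw [ENNReal.ofReal_one, ← μ.tsum_coe]
  exact ENNReal.sum_le_tsum s

/-! ### Random walks on orbits -/

lemma toReal_toOuterMeasure_convPow_eq {ι : Type*} [DecidableEq ι] (μ : PMF G)
    (hfin : μ.support.Finite) (σ : G →* Equiv.Perm ι) (T : Finset ι) (n : ℕ) :
    ∀ i, ((μ.convPow n).toOuterMeasure {g | σ g i ∈ T}).toReal =
      ((markovOperator σ hfin.toFinset fun h => (μ h).toReal) ^ n) (lpIndicator T) i := by
  induction n with
  | zero =>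
    intro i
    rw [convPow, toOuterMeasure_pure_apply, pow_zero, Module.End.one_apply, lpIndicator_apply]
    simp only [Set.mem_ofPred_eq, map_one, Equiv.Perm.coe_one, id_eq]
    split_ifs <;> simp
  | succ n ih =>
    intro i
    rw [toOuterMeasure_convPow_succ, pow_succ', Module.End.mul_apply, markovOperator_apply,
      tsum_eq_sum (s := hfin.toFinset), ENNReal.toReal_sum]
    · refine Finset.sum_congr rfl fun h _ => ?_
      rw [← ih, ENNReal.toReal_mul]
      simp [Set.preimage]
    · exact fun h _ => ENNReal.mul_ne_top (μ.apply_ne_top h) (toOuterMeasure_ne_top _ _)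
    · intro h hh
      rw [(μ.apply_eq_zero_iff h).2 (by simpa using hh), zero_mul]

lemma abs_sub_le_of_mem_support_convPow {μ : PMF G} {σ : G →* Equiv.Perm ℤ} {R : ℕ}
    (hR : ∀ h ∈ μ.support, ∀ i, |σ h i - i| ≤ R) (n : ℕ) :
    ∀ g ∈ (μ.convPow n).support, ∀ i, |σ g i - i| ≤ R * n := by
  induction n with
  | zero => simp [convPow]
  | succ n ih =>
    intro g hg i
    simp only [convPow, mem_support_bind_iff, mem_support_map_iff] at hg
    obtain ⟨a, ha, b, hb, rfl⟩ := hg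
    rw [map_mul, Equiv.Perm.mul_apply]
    have h1 := ih a ha (σ b i)
    have h2 := hR b hb i
    have h3 := abs_sub_le (σ a (σ b i)) (σ b i) i
    push_cast
    linarith

/-- Gaussian tail bound for the displacement of a symmetric random walk with bounded jumps
on `ℤ` induced by a group action. -/
lemma toOuterMeasure_convPow_displacement_le {μ : PMF G} (hfin : μ.support.Finite)
    (hsymm : ∀ g, μ g⁻¹ = μ g) (σ : G →* Equiv.Perm ℤ) {R : ℕ} (hR0 : R ≠ 0)
    (hR : ∀ h ∈ μ.support, ∀ i, |σ h i - i| ≤ R) (m n : ℕ) (hn : n ≠ 0) :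
    (μ.convPow n).toOuterMeasure {g | m < |σ g 0|} ≤
      ENNReal.ofReal (2 * (n + 1) * (2 * R * n + 1) * Real.exp (-(m ^ 2 / (2 * R ^ 2 * n)))) := by
  -- Bounded jumps confine the walk to `[-Rn, Rn]`, so the tail is a finite target. Its size gives
  -- the factor `2Rn + 1`.
  let T : Finset ℤ := (Finset.Icc (-(R * n : ℤ)) (R * n)).filter fun i => m < |i|
  have h1 : (μ.convPow n).toOuterMeasure {g | m < |σ g 0|} ≤
      (μ.convPow n).toOuterMeasure {g | σ g 0 ∈ T} := by
    refine toOuterMeasure_mono _ fun g hg => ?_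
    have := abs_sub_le_of_mem_support_convPow hR n g hg.2 0
    rw [sub_zero] at this
    simp only [T, Set.mem_ofPred_eq, Finset.mem_filter, Finset.mem_Icc]
    exact ⟨abs_le.1 this, hg.1⟩
  refine h1.trans ?_
  rw [← ENNReal.ofReal_toReal (toOuterMeasure_ne_top _ _), toReal_toOuterMeasure_convPow_eq μ hfin]
  refine ENNReal.ofReal_le_ofReal ((markovOperator_pow_lpIndicator_le σ (S := hfin.toFinset)
    (w := fun h => (μ h).toReal) ?_ ?_ ?_ ?_ R hR0 ?_ T m ?_ n hn).trans ?_)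
  · intro h hh
    rw [Set.Finite.mem_toFinset, mem_support_iff] at hh ⊢
    rwa [hsymm]
  · exact fun h => by rw [hsymm]
  · exact fun h => ENNReal.toReal_nonneg
  · exact sum_toReal_apply_le_one μ _
  · exact fun h hh => hR h (hfin.mem_toFinset.1 hh)
  · exact fun i hi => (Finset.mem_filter.1 hi).2
  · have h2 : T.card ≤ 2 * R * n + 1 := by
      refine (Finset.card_filter_le _ _).trans ?_
      rw [Int.card_Icc]
      have : (R * n : ℤ) + 1 - -(R * n : ℤ) = ((2 * R * n + 1 : ℕ) : ℤ) := by push_cast; ring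
      rw [this, Int.toNat_natCast]
    have h3 : (T.card : ℝ) ≤ 2 * R * n + 1 := by exact_mod_cast h2
    gcongr

/-! ### Products all of whose partial products avoid a set -/

/-- The set of products of `n` elements of `S` all of whose nonempty right factors avoid `D`. -/
def avoidingProducts (S D : Set G) : ℕ → Set G
  | 0 => {1}
  | n + 1 => {g | g ∉ D ∧ ∃ h ∈ S, ∃ q ∈ avoidingProducts S D n, g = h * q}

/-- A union bound without path space: an element outside the set lies in `D`, or has no admissible
factorization. In the latter case, stripping any first letter in the support leaves an element
outside the previous set. -/
lemma toOuterMeasure_compl_avoidingProducts_le (μ : PMF G) (D : Set G) (n : ℕ) :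
    (μ.convPow n).toOuterMeasure (avoidingProducts μ.support D n)ᶜ ≤
      ∑ j ∈ Finset.range n, (μ.convPow (j + 1)).toOuterMeasure D := by
  induction n with
  | zero => simp [convPow, avoidingProducts]
  | succ n ih =>
    rw [Finset.sum_range_succ, add_comm (Finset.sum _ _)]
    have h1 : (avoidingProducts μ.support D (n + 1))ᶜ =
        D ∪ {g | ¬ ∃ h ∈ μ.support, ∃ q ∈ avoidingProducts μ.support D n, g = h * q} := by
      ext g
      simp only [avoidingProducts, Set.mem_compl_iff, Set.mem_ofPred_eq, Set.mem_union]
      rw [not_and_or, not_not]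
    rw [h1]
    refine (MeasureTheory.measure_union_le _ _).trans (add_le_add le_rfl ((le_trans ?_ ih)))
    rw [toOuterMeasure_convPow_succ']
    calc _ ≤ ∑' h, μ h * (μ.convPow n).toOuterMeasure (avoidingProducts μ.support D n)ᶜ := by
          refine ENNReal.tsum_le_tsum fun h => ?_
          by_cases hh : μ h = 0
          · simp [hh]
          · gcongr
            exact fun q hq hq' => hq ⟨h, hh, q, hq', rfl⟩
      _ = _ := by rw [ENNReal.tsum_mul_right, tsum_coe, one_mul]

/-! ### Entropy -/

lemma _root_.Real.negMulLog_le_one {a : ℝ} (ha : 0 ≤ a) : Real.negMulLog a ≤ 1 := by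
  rcases ha.eq_or_lt with rfl | ha
  · simp
  · have h := Real.one_sub_inv_le_log_of_pos ha
    have h1 : a * (1 - a⁻¹) ≤ a * Real.log a := by gcongr
    rw [mul_sub, mul_inv_cancel₀ ha.ne', mul_one] at h1
    rw [Real.negMulLog]
    linarith

/-- Jensen with uniform weights bounds the sum by `negMulLog a + a log N`, with `a` the total mass
and `N` the cardinality. -/
lemma _root_.Real.sum_negMulLog_le {ι : Type*} (s : Finset ι) (p : ι → ℝ)
    (hp : ∀ i ∈ s, 0 ≤ p i) :
    ∑ i ∈ s, Real.negMulLog (p i) ≤ 1 + (∑ i ∈ s, p i) * Real.log s.card := by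
  rcases s.eq_empty_or_nonempty with rfl | hs
  · simp
  have hN : (0 : ℝ) < s.card := by exact_mod_cast hs.card_pos
  have h := Real.concaveOn_negMulLog.le_map_sum (t := s) (w := fun _ => (s.card : ℝ)⁻¹) (p := p)
    (fun i _ => by positivity) (by simp [hN.ne']) hp
  simp only [smul_eq_mul, ← Finset.mul_sum] at h
  set a := ∑ i ∈ s, p i
  have ha : 0 ≤ a := Finset.sum_nonneg hp
  rw [inv_mul_le_iff₀ hN] at h
  refine h.trans ?_
  refine le_trans (le_of_eq ?_) (add_le_add_left (Real.negMulLog_le_one ha) _)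
  rcases ha.eq_or_lt with h0 | h0
  · simp [← h0]
  · rw [Real.negMulLog, Real.negMulLog, Real.log_mul (by positivity) h0.ne', Real.log_inv]
    field_simp
    ring

/-- Split the sum into `F` and its complement; each piece costs `1` plus its mass times the
logarithm of its size. -/
lemma entropy_le {α : Type*} (ν : PMF α) (F T : Finset α) (hT : ν.support ⊆ T) {δ : ℝ}
    (hδ : 0 ≤ δ) (hF : ν.toOuterMeasure (F : Set α)ᶜ ≤ ENNReal.ofReal δ) :
    ν.entropy ≤ ENNReal.ofReal (2 + Real.log F.card + δ * Real.log T.card) := by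
  classical
  have hp : ∀ g, 0 ≤ (ν g).toReal := fun g => ENNReal.toReal_nonneg
  have hp1 : ∀ g, (ν g).toReal ≤ 1 := fun g => by
    simpa using ENNReal.toReal_mono ENNReal.one_ne_top (ν.coe_le_one g)
  rw [entropy, tsum_eq_sum (s := T), ← ENNReal.ofReal_sum_of_nonneg]
  · refine ENNReal.ofReal_le_ofReal ?_
    rw [← Finset.sum_filter_add_sum_filter_not T (· ∈ F)]
    have h1 := Real.sum_negMulLog_le (T.filter (· ∈ F)) (fun g => (ν g).toReal) fun i _ => hp i
    have h2 := Real.sum_negMulLog_le (T.filter (· ∉ F)) (fun g => (ν g).toReal) fun i _ => hp i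
    have h3 : ∀ U V : Finset α, U ⊆ V → Real.log U.card ≤ Real.log V.card := fun U V hUV => by
      rcases U.eq_empty_or_nonempty with rfl | hU
      · simpa using Real.log_natCast_nonneg _
      · have : (0 : ℝ) < U.card := by exact_mod_cast hU.card_pos
        exact Real.log_le_log this (by exact_mod_cast Finset.card_le_card hUV)
    have h4 : (∑ g ∈ T.filter (· ∈ F), (ν g).toReal) * Real.log (T.filter (· ∈ F)).card ≤
        1 * Real.log F.card :=
      mul_le_mul (sum_toReal_apply_le_one ν _)
        (h3 _ _ fun g hg => (Finset.mem_filter.1 hg).2) (Real.log_natCast_nonneg _) zero_le_one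
    have h5 : (∑ g ∈ T.filter (· ∉ F), (ν g).toReal) * Real.log (T.filter (· ∉ F)).card ≤
        δ * Real.log T.card := by
      refine mul_le_mul ?_ (h3 _ _ (Finset.filter_subset _ _)) (Real.log_natCast_nonneg _) hδ
      · rw [← ENNReal.toReal_sum fun a _ => ν.apply_ne_top a, ← toOuterMeasure_apply_finset]
        refine ENNReal.toReal_le_of_le_ofReal hδ (le_trans (MeasureTheory.measure_mono ?_) hF)
        exact fun g hg => (Finset.mem_filter.1 hg).2
    linarith
  · exact fun g _ => Real.negMulLog_nonneg (hp g) (hp1 g)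
  · intro g hg
    rw [(ν.apply_eq_zero_iff g).2 fun h => hg (hT h)]
    simp

end PMF

/-! ## The cocycle of the topological full group -/

namespace Homeomorph

variable {X : Type*} [TopologicalSpace X] {τ : X ≃ₜ X}

/-- Essential freeness: a nontrivial power of `τ` does not fix an open set pointwise. -/
def IsTopologicallyFree (τ : X ≃ₜ X) : Prop :=
  ∀ (x : X) (k : ℤ), (∀ᶠ y in 𝓝 x, (τ ^ k) y = y) → k = 0

lemma zpow_add_apply (τ : X ≃ₜ X) (k l : ℤ) (x : X) : (τ ^ (k + l)) x = (τ ^ k) ((τ ^ l) x) := by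
  rw [zpow_add]
  rfl

lemma exists_germ (g : τ.topologicalFullGroup) (x : X) :
    ∃ k : ℤ, ∀ᶠ y in 𝓝 x, g.1 y = (τ ^ k) y := by
  obtain ⟨U, hU, hx, k, hk⟩ := g.2 x
  exact ⟨k, mem_of_superset (hU.mem_nhds hx) hk⟩

/-- The integer `k` such that `g` coincides with `τ ^ k` near `x`. -/
noncomputable def cocycle (g : τ.topologicalFullGroup) (x : X) : ℤ := (exists_germ g x).choose

lemma cocycle_spec (g : τ.topologicalFullGroup) (x : X) :
    ∀ᶠ y in 𝓝 x, g.1 y = (τ ^ cocycle g x) y := (exists_germ g x).choose_spec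

lemma apply_eq_zpow_cocycle (g : τ.topologicalFullGroup) (x : X) :
    g.1 x = (τ ^ cocycle g x) x := (cocycle_spec g x).self_of_nhds

lemma cocycle_eq (hτ : τ.IsTopologicallyFree) {g : τ.topologicalFullGroup} {x : X} {k : ℤ}
    (h : ∀ᶠ y in 𝓝 x, g.1 y = (τ ^ k) y) : cocycle g x = k := by
  have : -k + cocycle g x = 0 := by
    refine hτ x _ ?_
    filter_upwards [h, cocycle_spec g x] with y h1 h2
    rw [zpow_add_apply, ← h2, h1, ← zpow_add_apply, neg_add_cancel, zpow_zero]
    rfl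
  linarith

lemma cocycle_one (hτ : τ.IsTopologicallyFree) (x : X) :
    cocycle (1 : τ.topologicalFullGroup) x = 0 :=
  cocycle_eq hτ (Eventually.of_forall fun _ => rfl)

lemma cocycle_mul (hτ : τ.IsTopologicallyFree) (g h : τ.topologicalFullGroup) (x : X) :
    cocycle (g * h) x = cocycle g (h.1 x) + cocycle h x := by
  refine cocycle_eq hτ ?_
  filter_upwards [cocycle_spec h x, (h.1.continuous.tendsto x).eventually (cocycle_spec g (h.1 x))]
    with y h1 h2
  rw [zpow_add_apply, ← h1, ← h2]
  rfl

lemma isLocallyConstant_cocycle (hτ : τ.IsTopologicallyFree) (g : τ.topologicalFullGroup) :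
    IsLocallyConstant (cocycle g) := by
  rw [IsLocallyConstant.iff_eventually_eq]
  intro x
  filter_upwards [eventually_eventually_nhds.2 (cocycle_spec g x)] with y hy
  exact cocycle_eq hτ hy

/-- The action of the topological full group on `ℤ` obtained by identifying `ℤ` with the
orbit of `x`. -/
noncomputable def orbitAction (hτ : τ.IsTopologicallyFree) (x : X) :
    τ.topologicalFullGroup →* Equiv.Perm ℤ :=
  -- Bijectivity is automatic, since a group is being mapped to self-maps of ℤ; multiplicativity is
  -- the cocycle identity.
  MonoidHom.toHomPerm
    { toFun := fun g => (fun i => cocycle g ((τ ^ i) x) + i : ℤ → ℤ)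
      map_one' := by
        funext i
        rw [cocycle_one hτ, zero_add]
        rfl
      map_mul' := by
        intro g h
        funext i
        change _ = cocycle g ((τ ^ (cocycle h ((τ ^ i) x) + i)) x) + (cocycle h ((τ ^ i) x) + i)
        rw [zpow_add_apply, ← apply_eq_zpow_cocycle, cocycle_mul hτ, add_assoc] }

lemma orbitAction_apply (hτ : τ.IsTopologicallyFree) (x : X) (g : τ.topologicalFullGroup) (i : ℤ) :
    orbitAction hτ x g i = cocycle g ((τ ^ i) x) + i := rfl

lemma orbitAction_apply_zero (hτ : τ.IsTopologicallyFree) (x : X) (g : τ.topologicalFullGroup) :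
    orbitAction hτ x g 0 = cocycle g x := by
  rw [orbitAction_apply, zpow_zero, add_zero]
  rfl

lemma exists_abs_cocycle_le [CompactSpace X] (hτ : τ.IsTopologicallyFree)
    (S : Finset τ.topologicalFullGroup) : ∃ R : ℕ, ∀ g ∈ S, ∀ x, |cocycle g x| ≤ R := by
  have h : ∀ g : τ.topologicalFullGroup, ∃ R : ℕ, ∀ x, |cocycle g x| ≤ R := fun g => by
    obtain ⟨B, hB⟩ := ((isLocallyConstant_cocycle hτ g).range_finite.image
      fun k : ℤ => k.natAbs).bddAbove
    refine ⟨B, fun x => ?_⟩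
    have := hB ⟨_, ⟨x, rfl⟩, rfl⟩
    rw [Int.abs_eq_natAbs]
    exact_mod_cast this
  choose R hR using h
  exact ⟨S.sup R, fun g hg x => (hR g x).trans (by exact_mod_cast Finset.le_sup (f := R) hg)⟩

end Homeomorph

/-! ## Subshifts -/

namespace SymbolicDynamics.FullShift.Subshift

open Homeomorph

variable {A : Type*} [TopologicalSpace A] (Y : SymbolicDynamics.FullShift.Subshift A ℤ)

lemma shiftHomeo_zpow_apply (k : ℤ) (x : Y.carrier) (i : ℤ) :
    ((Y.shiftHomeo ^ k) x).1 i = x.1 (k + i) := by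
  have h1 : ∀ (n : ℕ) (x : Y.carrier) (i : ℤ), ((Y.shiftHomeo ^ n) x).1 i = x.1 (n + i) := by
    intro n
    induction n with
    | zero => intro x i; simp
    | succ n ih =>
      intro x i
      rw [pow_succ']
      change ((Y.shiftHomeo ^ n) x).1 (1 + i) = _
      rw [ih]
      exact congrArg x.1 (by push_cast; ring)
  obtain ⟨n, rfl | rfl⟩ := k.eq_nat_or_neg
  · rw [zpow_natCast, h1]
  · have h2 := h1 n ((Y.shiftHomeo ^ (-n : ℤ)) x) (-n + i)
    rw [← zpow_natCast, ← zpow_add_apply, add_neg_cancel, add_neg_cancel_left] at h2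
    exact h2.symm

lemma finite_fixedPoints_zpow [Finite A] {k : ℤ} (hk : k ≠ 0) :
    {y : Y.carrier | (Y.shiftHomeo ^ k) y = y}.Finite := by
  have hper : ∀ y : Y.carrier, (Y.shiftHomeo ^ k) y = y → ∀ i, y.1 i = y.1 (i % k) := by
    intro y hy i
    have h1 : Function.Periodic y.1 k := fun j => by
      conv_rhs => rw [← hy]
      rw [shiftHomeo_zpow_apply, add_comm]
    have h2 := h1.sub_int_mul_eq (x := i) (i / k)
    rw [← h2, Int.emod_def, mul_comm, Int.cast_id]
  have : Finite (Set.Ico 0 |k| → A) := inferInstance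
  refine Set.Finite.of_finite_image (f := fun y (i : Set.Ico 0 |k|) => y.1 i) (Set.toFinite _) ?_
  intro y hy z hz h
  ext i
  rw [hper y hy, hper z hz]
  exact congrFun h ⟨i % k, Int.emod_nonneg i hk, Int.emod_lt_abs i hk⟩

/-- A fixed point of `τ ^ k`, `k ≠ 0`, is determined by `|k|` letters, so there are finitely many.
An open set of them would consist of isolated periodic points. -/
lemma isTopologicallyFree_shiftHomeo [Finite A] [DiscreteTopology A]
    (hper : ∀ x : Y.carrier, x ∈ Function.periodicPts Y.shiftHomeo → ¬ IsOpen {x}) :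
    Y.shiftHomeo.IsTopologicallyFree := by
  intro x k hk
  by_contra hk0
  refine hper x ?_ (isOpen_singleton_of_finite_mem_nhds x hk (Y.finite_fixedPoints_zpow hk0))
  have h1 : (Y.shiftHomeo ^ k) x = x := hk.self_of_nhds
  have h2 : (Y.shiftHomeo ^ k.natAbs) x = x := by
    rw [← zpow_natCast]
    rcases Int.natAbs_eq k with h | h
    · rw [← h, h1]
    · rw [h] at h1
      conv_lhs => rw [← h1]
      rw [← zpow_add_apply, add_neg_cancel, zpow_zero]
      rfl
  refine Function.mem_periodicPts.2 ⟨k.natAbs, Int.natAbs_pos.2 hk0, ?_⟩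
  have h3 : ∀ n : ℕ, Y.shiftHomeo^[n] x = (Y.shiftHomeo ^ n) x := fun n => by
    induction n with
    | zero => rfl
    | succ n ih => rw [Function.iterate_succ_apply', ih, pow_succ']; rfl
  rw [Function.IsPeriodicPt, Function.IsFixedPt, h3, h2]

instance [Finite A] [DiscreteTopology A] : CompactSpace Y.carrier :=
  isCompact_iff_compactSpace.1 Y.isClosed.isCompact

/-- Locally constant functions on a subshift depend on finitely many coordinates. -/
lemma exists_window [Finite A] [DiscreteTopology A] {B : Type*} {f : Y.carrier → B}
    (hf : IsLocallyConstant f) :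
    ∃ r : ℕ, ∀ x y : Y.carrier, (∀ i : ℤ, |i| ≤ r → x.1 i = y.1 i) → f x = f y := by
  have h1 : ∀ x : Y.carrier, ∃ I : Finset ℤ, ∀ y : Y.carrier,
      (∀ i ∈ I, y.1 i = x.1 i) → f y = f x := by
    intro x
    obtain ⟨U, hU, hUeq⟩ := isOpen_induced_iff.1 (hf.isOpen_fiber (f x))
    have hx : x.1 ∈ U := by
      have : x ∈ Subtype.val ⁻¹' U := by rw [hUeq]; rfl
      exact this
    obtain ⟨I, u, hu, hIu⟩ := isOpen_pi_iff.1 hU x.1 hx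
    refine ⟨I, fun y hy => ?_⟩
    have : y ∈ Subtype.val ⁻¹' U := hIu fun i hi => by rw [hy i hi]; exact (hu i hi).2
    rw [hUeq] at this
    exact this
  choose I hI using h1
  obtain ⟨t, ht⟩ := isCompact_univ.elim_nhds_subcover
    (fun x : Y.carrier => Subtype.val ⁻¹' cylinder (I x) x.1)
    fun x _ => ((isOpen_cylinder (I x) x.1).preimage continuous_subtype_val).mem_nhds
      fun _ _ => rfl
  refine ⟨t.sup fun x => (I x).sup Int.natAbs, fun x y hxy => ?_⟩
  obtain ⟨z, hz, hxz⟩ := Set.mem_iUnion₂.1 (ht.2 (Set.mem_univ x))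
  have hx : ∀ i ∈ I z, x.1 i = z.1 i := hxz
  rw [hI z x hx, hI z y fun i hi => ?_]
  rw [← hx i hi, hxy]
  rw [Int.abs_eq_natAbs]
  exact_mod_cast (Finset.le_sup (f := Int.natAbs) hi).trans
    (Finset.le_sup (f := fun x => (I x).sup Int.natAbs) hz)

lemma exists_cocycle_window [Finite A] [DiscreteTopology A]
    (hτ : Y.shiftHomeo.IsTopologicallyFree) (S : Finset Y.shiftHomeo.topologicalFullGroup) :
    ∃ r : ℕ, ∀ g ∈ S, ∀ x y : Y.carrier,
      (∀ i : ℤ, |i| ≤ r → x.1 i = y.1 i) → cocycle g x = cocycle g y := by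
  choose r hr using fun g => Y.exists_window (isLocallyConstant_cocycle hτ g)
  refine ⟨S.sup r, fun g hg x y h => hr g x y fun i hi => h i (hi.trans ?_)⟩
  exact_mod_cast Finset.le_sup (f := r) hg

/-! ### Complexity -/

lemma complexity_mono [Finite A] {m n : ℕ} (h : m ≤ n) : Y.complexity m ≤ Y.complexity n := by
  have h1 : {w : Fin m → A | Y.IsWord w} ⊆
      (fun (w : Fin n → A) (j : Fin m) => w (Fin.castLE h j)) '' {w | Y.IsWord w} := by
    rintro w ⟨x, hx, i, hw⟩
    exact ⟨fun j => x (i + j), ⟨x, hx, i, fun _ => rfl⟩, funext fun j => (hw j).symm⟩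
  exact (Set.ncard_le_ncard h1 (Set.toFinite _)).trans (Set.ncard_image_le (Set.toFinite _))

lemma complexity_pos [Finite A] (h : Y.carrier.Nonempty) (n : ℕ) : 0 < Y.complexity n := by
  obtain ⟨x, hx⟩ := h
  exact (Set.ncard_pos (Set.toFinite _)).2 ⟨fun j : Fin n => x (0 + j), x, hx, 0, fun _ => rfl⟩

/-- The word of `x` on the window `[-M, M]`. -/
def centralWord (M : ℕ) (x : Y.carrier) : Fin (2 * M + 1) → A := fun j => x.1 (-M + j)

variable {Y} in
lemma eq_of_centralWord_eq {M : ℕ} {x y : Y.carrier} (h : Y.centralWord M x = Y.centralWord M y)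
    {i : ℤ} (hi : |i| ≤ M) : x.1 i = y.1 i := by
  have := congrFun h ⟨(i + M).toNat, by have := abs_le.1 hi; omega⟩
  have h2 : (-M : ℤ) + ((i + M).toNat : ℤ) = i := by have := abs_le.1 hi; omega
  simpa only [centralWord, h2] using this

lemma card_range_centralWord_le [Finite A] (M : ℕ) :
    Nat.card (Set.range (Y.centralWord M)) ≤ Y.complexity (2 * M + 1) := by
  rw [Nat.card_coe_set_eq]
  refine Set.ncard_le_ncard ?_ (Set.toFinite _)
  rintro _ ⟨x, rfl⟩
  exact ⟨x.1, x.2, -M, fun _ => rfl⟩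

/-! ### Elements of the topological full group with a small local rule -/

/-- Elements whose cocycle is bounded by `m` and depends only on the window `[-M, M]`. -/
def localElements (m M : ℕ) : Set Y.shiftHomeo.topologicalFullGroup :=
  {g | (∀ x, |cocycle g x| ≤ m) ∧
    ∀ x y, Y.centralWord M x = Y.centralWord M y → cocycle g x = cocycle g y}

/-- The cocycle determines the element, and here it amounts to a map from words to `[-m, m]`. -/
lemma finite_localElements_and_card_le [Finite A] (m M : ℕ) :
    (Y.localElements m M).Finite ∧
      Nat.card (Y.localElements m M) ≤ (2 * m + 1) ^ Y.complexity (2 * M + 1) := by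
  let W := Set.range (Y.centralWord M)
  have : Finite W := Set.toFinite _
  let F : Y.localElements m M → W → Set.Icc (-m : ℤ) m := fun g w =>
    ⟨cocycle g.1 w.2.choose, abs_le.1 (g.2.1 _)⟩
  have hF : Function.Injective F := by
    intro g h hgh
    ext x : 3
    have h1 : cocycle g.1 x = cocycle h.1 x := by
      let w : W := ⟨Y.centralWord M x, x, rfl⟩
      have h2 := congrArg Subtype.val (congrFun hgh w)
      have h3 := w.2.choose_spec
      rw [g.2.2 x _ h3.symm, h.2.2 x _ h3.symm]
      exact h2
    rw [apply_eq_zpow_cocycle, apply_eq_zpow_cocycle, h1]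
  have : Finite (W → Set.Icc (-m : ℤ) m) := inferInstance
  refine ⟨Finite.of_injective F hF, (Nat.card_le_card_of_injective F hF).trans ?_⟩
  rw [Nat.card_fun]
  have h1 : Nat.card (Set.Icc (-m : ℤ) m) = 2 * m + 1 := by
    rw [Nat.card_eq_fintype_card, Fintype.card_ofFinset, Int.card_Icc]
    omega
  rw [h1]
  exact Nat.pow_le_pow_right (by omega) (Y.card_range_centralWord_le M)

lemma avoidingProducts_subset_localElements (hτ : Y.shiftHomeo.IsTopologicallyFree) {r m : ℕ}
    {S D : Set Y.shiftHomeo.topologicalFullGroup}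
    (hr : ∀ g ∈ S, ∀ x y : Y.carrier,
      (∀ i : ℤ, |i| ≤ r → x.1 i = y.1 i) → cocycle g x = cocycle g y)
    (hD : ∀ g ∉ D, ∀ x, ∃ y, Y.centralWord (m + r) x = Y.centralWord (m + r) y ∧
      |cocycle g y| ≤ m) (n : ℕ) :
    PMF.avoidingProducts S D n ⊆ Y.localElements m (m + r) := by
  induction n with
  | zero =>
    rintro g rfl
    simp [localElements, cocycle_one hτ]
  | succ n ih =>
    rintro g ⟨hg, h, hh, q, hq, rfl⟩
    have h1 : ∀ x y, Y.centralWord (m + r) x = Y.centralWord (m + r) y →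
        cocycle (h * q) x = cocycle (h * q) y := by
      intro x y hxy
      have h2 := (ih hq).2 x y hxy
      rw [cocycle_mul hτ, cocycle_mul hτ, h2]
      congr 1
      -- Near `0`, `q x` is `x` read around position `cocycle q x`, which is at most `m` in absolute
      -- value.
      refine hr h hh _ _ fun i hi => ?_
      rw [apply_eq_zpow_cocycle q x, apply_eq_zpow_cocycle q y, h2, shiftHomeo_zpow_apply,
        shiftHomeo_zpow_apply]
      refine eq_of_centralWord_eq hxy ?_
      push_cast
      exact (abs_add_le _ _).trans (add_le_add ((ih hq).1 y) hi)
    -- Locality comes first: it transfers the bound from one representative of each word to all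
    -- points.
    refine ⟨fun x => ?_, h1⟩
    obtain ⟨y, hy, hym⟩ := hD _ hg x
    rwa [h1 x y hy]

/-- The basic entropy estimate, with a free scale `m`. -/
lemma exists_entropy_convPow_le [Finite A] [DiscreteTopology A]
    (hper : ∀ x : Y.carrier, x ∈ Function.periodicPts Y.shiftHomeo → ¬ IsOpen {x})
    (μ : PMF Y.shiftHomeo.topologicalFullGroup) (hfin : μ.support.Finite)
    (hsymm : ∀ g, μ g⁻¹ = μ g) :
    ∃ r R : ℕ, R ≠ 0 ∧ ∀ m n : ℕ, (μ.convPow n).entropy ≤ ENNReal.ofReal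
      (2 + Y.complexity (2 * (m + r) + 1) * Real.log (2 * m + 1) +
        n * (Y.complexity (2 * (m + r) + 1) *
          (2 * (n + 1) * (2 * R * n + 1) * Real.exp (-(m ^ 2 / (2 * R ^ 2 * n))))) *
        (n * Real.log hfin.toFinset.card)) := by
  have hτ := Y.isTopologicallyFree_shiftHomeo hper
  obtain ⟨r, hr⟩ := Y.exists_cocycle_window hτ hfin.toFinset
  obtain ⟨R, hR⟩ := exists_abs_cocycle_le hτ hfin.toFinset
  refine ⟨r, R + 1, by omega, fun m n => ?_⟩
  simp only [Set.Finite.mem_toFinset] at hr hR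
  set M := m + r
  set ρ := Y.complexity (2 * M + 1)
  obtain ⟨hF, hFc⟩ := Y.finite_localElements_and_card_le m M
  obtain ⟨T, hT, hTc⟩ := μ.exists_finset_support_convPow hfin n
  let W := Set.range (Y.centralWord M)
  have : Finite W := Set.toFinite _
  have := Fintype.ofFinite W
  -- One point per word keeps the union bound finite.
  let x : W → Y.carrier := fun w => w.2.choose
  have hx : ∀ w : W, Y.centralWord M (x w) = w := fun w => w.2.choose_spec
  let D : Set Y.shiftHomeo.topologicalFullGroup :=
    ⋃ w : W, {g | (m : ℤ) < |orbitAction hτ (x w) g 0|}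
  have hsub := Y.avoidingProducts_subset_localElements hτ (S := μ.support) (D := D) (m := m) hr
    (by
      intro g hg y
      refine ⟨x ⟨_, y, rfl⟩, (hx ⟨_, y, rfl⟩).symm, ?_⟩
      simp only [D, Set.mem_iUnion, not_exists] at hg
      have := hg ⟨_, y, rfl⟩
      rw [Set.mem_ofPred_eq, not_lt, orbitAction_apply_zero] at this
      exact this) n
  set b : ℝ := 2 * (n + 1) * (2 * (R + 1 : ℕ) * n + 1) *
    Real.exp (-(m ^ 2 / (2 * (R + 1 : ℕ) ^ 2 * n)))
  have hb : 0 ≤ b := by positivity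
  have hD : ∀ j ∈ Finset.range n,
      (μ.convPow (j + 1)).toOuterMeasure D ≤ ENNReal.ofReal (ρ * b) := by
    intro j hj
    have hjn : j + 1 ≤ n := Finset.mem_range.1 hj
    have hjn' : ((j + 1 : ℕ) : ℝ) ≤ n := by exact_mod_cast hjn
    calc _ ≤ ∑ w : W, (μ.convPow (j + 1)).toOuterMeasure {g | m < |orbitAction hτ (x w) g 0|} :=
          MeasureTheory.measure_iUnion_fintype_le _ _
      _ ≤ ∑ w : W, ENNReal.ofReal b := by
        refine Finset.sum_le_sum fun w _ => ?_
        refine (PMF.toOuterMeasure_convPow_displacement_le hfin hsymm _ (R := R + 1) (by omega)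
          (fun h hh i => ?_) m (j + 1) (by omega)).trans ?_
        · rw [orbitAction_apply, add_sub_cancel_right]
          exact (hR h hh _).trans (by push_cast; linarith)
        · refine ENNReal.ofReal_le_ofReal ?_
          simp only [b]
          gcongr
      _ = ENNReal.ofReal (Fintype.card W * b) := by
        rw [Finset.sum_const, Finset.card_univ, nsmul_eq_mul,
          ENNReal.ofReal_mul (Nat.cast_nonneg _), ENNReal.ofReal_natCast]
      _ ≤ _ := by
        refine ENNReal.ofReal_le_ofReal ?_
        gcongr
        rw [← Nat.card_eq_fintype_card]
        exact Y.card_range_centralWord_le M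
  have hbad : (μ.convPow n).toOuterMeasure (hF.toFinset : Set _)ᶜ ≤
      ENNReal.ofReal (n * (ρ * b)) := by
    rw [hF.coe_toFinset]
    calc _ ≤ (μ.convPow n).toOuterMeasure (PMF.avoidingProducts μ.support D n)ᶜ :=
          MeasureTheory.measure_mono (Set.compl_subset_compl.2 hsub)
      _ ≤ ∑ j ∈ Finset.range n, (μ.convPow (j + 1)).toOuterMeasure D :=
          μ.toOuterMeasure_compl_avoidingProducts_le D n
      _ ≤ ∑ j ∈ Finset.range n, ENNReal.ofReal (ρ * b) := Finset.sum_le_sum hD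
      _ = _ := by
        rw [Finset.sum_const, Finset.card_range, nsmul_eq_mul,
          ← ENNReal.ofReal_natCast n, ← ENNReal.ofReal_mul (Nat.cast_nonneg _)]
  refine ((μ.convPow n).entropy_le hF.toFinset T hT (by positivity) hbad).trans ?_
  have hlog : ∀ a c : ℕ, a ≤ c → Real.log a ≤ Real.log c := fun a c h => by
    rcases Nat.eq_zero_or_pos a with rfl | ha
    · simpa using Real.log_natCast_nonneg c
    · exact Real.log_le_log (by exact_mod_cast ha) (by exact_mod_cast h)
  refine ENNReal.ofReal_le_ofReal (add_le_add (add_le_add le_rfl ?_) ?_)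
  · have h1 := hlog _ _ hFc
    rw [Nat.card_eq_card_finite_toFinset hF] at h1
    push_cast at h1
    rwa [Real.log_pow] at h1
  · have h1 := hlog _ _ hTc
    push_cast at h1
    rw [Real.log_pow] at h1
    exact mul_le_mul_of_nonneg_left h1 (by positivity)

end SymbolicDynamics.FullShift.Subshift

/-! ## Optimizing the scale -/

lemma PMF.entropy_eq_zero_of_subsingleton {α : Type*} [Subsingleton α] (ν : PMF α) :
    ν.entropy = 0 := by
  refine ENNReal.tsum_eq_zero.2 fun g => ?_
  have h : ν g = 1 := by
    rw [← ν.tsum_coe, tsum_eq_single g fun g' hg' => absurd (Subsingleton.elim g' g) hg']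
  simp [h]

lemma one_half_le_log_natCast {n : ℕ} (hn : 2 ≤ n) : 1 / 2 ≤ Real.log n := by
  have h1 : Real.log 2 ≤ Real.log n := Real.log_le_log (by norm_num) (by exact_mod_cast hn)
  linarith [Real.log_two_gt_d9]

lemma one_le_sqrt_mul_log {n : ℕ} (hn : 2 ≤ n) : 1 ≤ Real.sqrt (n * Real.log n) := by
  have h1 := one_half_le_log_natCast hn
  have h2 : (2 : ℝ) ≤ n := by exact_mod_cast hn
  refine Real.one_le_sqrt.2 ?_
  nlinarith

lemma sqrt_mul_log_le (n : ℕ) : Real.sqrt (n * Real.log n) ≤ n := by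
  refine Real.sqrt_le_iff.2 ⟨by positivity, ?_⟩
  rw [sq]
  gcongr
  exact Real.log_le_self (by positivity)

lemma sq_sqrt_mul_log (n : ℕ) : Real.sqrt (n * Real.log n) ^ 2 = n * Real.log n :=
  Real.sq_sqrt (mul_nonneg (Nat.cast_nonneg _) (Real.log_natCast_nonneg n))

namespace SymbolicDynamics.FullShift.Subshift

variable {A : Type*} [TopologicalSpace A] (Y : SymbolicDynamics.FullShift.Subshift A ℤ)

/-- For large `n` the hypothesis bounds `(log n)² ρ(n)` by `n²`, and `log n ≥ 1/2` gives the
constant `4`; the other term covers small `n`. -/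
lemma exists_complexity_le_mul_sq [Finite A]
    (hρ : Tendsto (fun n : ℕ => (Real.log n / n) ^ 2 * (Y.complexity n : ℝ)) atTop (𝓝 0)) :
    ∃ K : ℝ, 0 ≤ K ∧ ∀ n : ℕ, 1 ≤ n → (Y.complexity n : ℝ) ≤ K * n ^ 2 := by
  obtain ⟨N, hN⟩ := eventually_atTop.1 (hρ.eventually (ge_mem_nhds one_pos))
  refine ⟨4 + Y.complexity (N + 2), by positivity, fun n hn => ?_⟩
  have hn1 : (1 : ℝ) ≤ n := by exact_mod_cast hn
  have hn2 : (1 : ℝ) ≤ (n : ℝ) ^ 2 := one_le_pow₀ hn1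
  rcases le_total n (N + 2) with h | h
  · have h1 : (Y.complexity n : ℝ) ≤ Y.complexity (N + 2) := by
      exact_mod_cast Y.complexity_mono h
    calc (Y.complexity n : ℝ) ≤ (4 + Y.complexity (N + 2)) * 1 := by linarith
      _ ≤ _ := by gcongr
  · have h1 := hN n (by omega)
    have h2 := one_half_le_log_natCast (n := n) (by omega)
    have h3 : (1 / 2 : ℝ) ^ 2 * Y.complexity n ≤ n ^ 2 := by
      calc (1 / 2 : ℝ) ^ 2 * Y.complexity n ≤ Real.log n ^ 2 * Y.complexity n := by gcongr
        _ = n ^ 2 * ((Real.log n / n) ^ 2 * Y.complexity n) := by field_simp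
        _ ≤ n ^ 2 * 1 := by gcongr
        _ = _ := mul_one _
    have h4 : (0 : ℝ) ≤ Y.complexity (N + 2) * n ^ 2 := by positivity
    linarith

lemma exists_entropy_convPow_le_complexity [Finite A] [DiscreteTopology A]
    (hper : ∀ x : Y.carrier, x ∈ Function.periodicPts Y.shiftHomeo → ¬ IsOpen {x})
    (hρ : Tendsto (fun n : ℕ => (Real.log n / n) ^ 2 * (Y.complexity n : ℝ)) atTop (𝓝 0))
    (μ : PMF Y.shiftHomeo.topologicalFullGroup) (hfin : μ.support.Finite)
    (hsymm : ∀ g, μ g⁻¹ = μ g) :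
    ∃ C : ℝ, 1 ≤ C ∧ ∀ n : ℕ, 2 ≤ n → (μ.convPow n).entropy ≤
      ENNReal.ofReal (C * (Y.complexity ⌈C * Real.sqrt (n * Real.log n)⌉₊ : ℝ) * Real.log n) := by
  -- For the empty subshift the complexity vanishes, but the group is trivial.
  rcases Y.carrier.eq_empty_or_nonempty with hY | hY
  · have : IsEmpty Y.carrier := Set.isEmpty_coe_sort.2 hY
    have : Subsingleton Y.shiftHomeo.topologicalFullGroup :=
      ⟨fun g h => Subtype.ext (Homeomorph.ext fun x => isEmptyElim x)⟩
    exact ⟨1, le_rfl, fun n _ => by simp [PMF.entropy_eq_zero_of_subsingleton]⟩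
  obtain ⟨K, hK0, hK⟩ := Y.exists_complexity_le_mul_sq hρ
  obtain ⟨r, R, hR0, hH⟩ := Y.exists_entropy_convPow_le hper μ hfin hsymm
  have hR : (1 : ℝ) ≤ R := by exact_mod_cast Nat.one_le_iff_ne_zero.2 hR0
  set s := hfin.toFinset.card
  have hs : 0 ≤ Real.log s := Real.log_natCast_nonneg s
  set C₀ : ℝ := 8 * R + 2 * r + 3
  have hC₀ : 1 ≤ C₀ := by
    have : (0 : ℝ) ≤ r := by positivity
    simp only [C₀]
    linarith
  have hlC₀ : 0 ≤ Real.log C₀ := Real.log_nonneg hC₀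
  set B : ℝ := 12 * K * C₀ ^ 2 * R * Real.log s
  have hB : 0 ≤ B := by positivity
  set C₁ : ℝ := 4 + (2 * Real.log C₀ + 1) + 2 * B
  have hC₁ : 0 ≤ C₁ := by positivity
  -- `C₀` is large enough for the window length and `C₁` for the prefactor; their sum serves in both
  -- places.
  refine ⟨C₀ + C₁, by linarith, fun n hn => ?_⟩
  set L := Real.sqrt (n * Real.log n)
  have hL1 : 1 ≤ L := one_le_sqrt_mul_log hn
  have hLn : L ≤ n := sqrt_mul_log_le n
  have hL2 : L ^ 2 = n * Real.log n := sq_sqrt_mul_log n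
  have hn1 : (1 : ℝ) ≤ n := by linarith
  have hlog : 1 / 2 ≤ Real.log n := one_half_le_log_natCast hn
  set m := ⌈4 * R * L⌉₊
  have hm : 4 * R * L ≤ m := Nat.le_ceil _
  have hm' : (m : ℝ) ≤ 4 * R * L + 1 := (Nat.ceil_lt_add_one (by positivity)).le
  set M := 2 * (m + r) + 1
  have hM : (M : ℝ) ≤ C₀ * L := by
    have h1 : (r : ℝ) * 1 ≤ r * L := by gcongr
    simp only [M, C₀]
    push_cast
    linarith
  set ρ := Y.complexity ⌈(C₀ + C₁) * L⌉₊
  have hρ1 : (1 : ℝ) ≤ ρ := by exact_mod_cast Y.complexity_pos hY _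
  have hMρ : (Y.complexity M : ℝ) ≤ ρ := by
    have h1 : (M : ℝ) ≤ (⌈(C₀ + C₁) * L⌉₊ : ℝ) := by
      refine (hM.trans ?_).trans (Nat.le_ceil _)
      gcongr
      linarith
    exact_mod_cast Y.complexity_mono (by exact_mod_cast h1)
  have hρlog : 1 / 2 ≤ ρ * Real.log n := by nlinarith
  refine (hH m n).trans (ENNReal.ofReal_le_ofReal ?_)
  have term2 : Y.complexity M * Real.log (2 * m + 1) ≤
      ρ * ((2 * Real.log C₀ + 1) * Real.log n) := by
    have h1 : (2 * m + 1 : ℝ) ≤ C₀ * n := by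
      have h2 : (2 * m + 1 : ℝ) ≤ M := by
        simp only [M]
        push_cast
        linarith [(Nat.cast_nonneg r : (0 : ℝ) ≤ r)]
      exact h2.trans (hM.trans (by gcongr))
    have h3 : Real.log (2 * m + 1) ≤ Real.log C₀ + Real.log n := by
      rw [← Real.log_mul (by positivity) (by positivity)]
      exact Real.log_le_log (by positivity) h1
    have h4 : Real.log (2 * m + 1) ≤ (2 * Real.log C₀ + 1) * Real.log n := by nlinarith
    have h5 : 0 ≤ Real.log (2 * m + 1) := Real.log_nonneg (by
      linarith [(Nat.cast_nonneg m : (0 : ℝ) ≤ m)])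
    gcongr
  -- The factor `4R` in `m` produces the exponent `8`. The other factors of the error term
  -- contribute at most order `n ^ 6`.
  have hexp : Real.exp (-(m ^ 2 / (2 * R ^ 2 * n))) ≤ ((n : ℝ) ^ 8)⁻¹ := by
    have h1 : 8 * Real.log n ≤ m ^ 2 / (2 * R ^ 2 * n) := by
      rw [le_div_iff₀ (by positivity)]
      calc 8 * Real.log n * (2 * R ^ 2 * n) = (4 * R * L) ^ 2 := by rw [mul_pow, hL2]; ring
        _ ≤ (m : ℝ) ^ 2 := by gcongr
    calc _ ≤ Real.exp (-(8 * Real.log n)) := by gcongr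
      _ = _ := by
        rw [Real.exp_neg, show 8 * Real.log n = Real.log ((n : ℝ) ^ 8) by
          rw [Real.log_pow]; norm_num, Real.exp_log (by positivity)]
  have term3 : n * (Y.complexity M * (2 * (n + 1) * (2 * R * n + 1) *
      Real.exp (-(m ^ 2 / (2 * R ^ 2 * n))))) * (n * Real.log s) ≤ B := by
    have h1 : (Y.complexity M : ℝ) ≤ K * (C₀ * n) ^ 2 := by
      refine (hK M (by omega)).trans ?_
      have : (M : ℝ) ≤ C₀ * n := hM.trans (by gcongr)
      gcongr
    have h2 : (n + 1 : ℝ) ≤ 2 * n := by linarith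
    have h3 : (2 * R * n + 1 : ℝ) ≤ 3 * R * n := by nlinarith
    calc _ ≤ n * (K * (C₀ * n) ^ 2 * (2 * (2 * n) * (3 * R * n) * ((n : ℝ) ^ 8)⁻¹)) *
          (n * Real.log s) := by gcongr
      _ = B * ((n : ℝ) ^ 2)⁻¹ := by
        simp only [B]
        field_simp
        ring
      _ ≤ B * 1 := by
        gcongr
        exact inv_le_one_of_one_le₀ (one_le_pow₀ hn1)
      _ = B := mul_one B
  calc _ ≤ 4 * (ρ * Real.log n) + ρ * ((2 * Real.log C₀ + 1) * Real.log n) +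
        2 * B * (ρ * Real.log n) := by
        refine add_le_add (add_le_add (by linarith) term2) (term3.trans ?_)
        nlinarith
    _ = C₁ * ρ * Real.log n := by simp only [C₁]; ring
    _ ≤ (C₀ + C₁) * ρ * Real.log n := by
      gcongr
      linarith

/-- The normalized complexity bound at scale `√(n log n)` tends to zero. -/
lemma tendsto_complexity_mul_log_div
    (hρ : Tendsto (fun n : ℕ => (Real.log n / n) ^ 2 * (Y.complexity n : ℝ)) atTop (𝓝 0))
    {C : ℝ} (hC : 1 ≤ C) :
    Tendsto (fun n : ℕ => C * (Y.complexity ⌈C * Real.sqrt (n * Real.log n)⌉₊ : ℝ) *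
      Real.log n / n) atTop (𝓝 0) := by
  have hsqrt : ∀ n : ℕ, 3 ≤ n →
      Real.sqrt n ≤ (⌈C * Real.sqrt (n * Real.log n)⌉₊ : ℝ) := by
    intro n hn
    refine le_trans ?_ (Nat.le_ceil _)
    have h3 : (3 : ℝ) ≤ n := by exact_mod_cast hn
    have h1 : 1 ≤ Real.log n := by
      rw [Real.le_log_iff_exp_le (by linarith)]
      linarith [Real.exp_one_lt_d9]
    calc Real.sqrt n ≤ 1 * Real.sqrt (n * Real.log n) := by
          rw [one_mul]
          exact Real.sqrt_le_sqrt (le_mul_of_one_le_right (by positivity) h1)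
      _ ≤ _ := by gcongr
  have hk : Tendsto (fun n : ℕ => ⌈C * Real.sqrt (n * Real.log n)⌉₊) atTop atTop := by
    refine tendsto_natCast_atTop_iff (R := ℝ).1 ?_
    refine tendsto_atTop_mono' atTop ?_ (Real.tendsto_sqrt_atTop.comp tendsto_natCast_atTop_atTop)
    filter_upwards [eventually_ge_atTop 3] with n hn using hsqrt n hn
  have hlim := (hρ.comp hk).const_mul (C * (4 * (C + 1) ^ 2))
  rw [mul_zero] at hlim
  refine squeeze_zero' (Eventually.of_forall fun n => ?_) ?_ hlim
  · have := Real.log_natCast_nonneg n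
    positivity
  · filter_upwards [eventually_ge_atTop 3] with n hn
    simp only [Function.comp_apply]
    have hsq := hsqrt n hn
    set L := Real.sqrt (n * Real.log n)
    set k := ⌈C * L⌉₊
    have hL1 : 1 ≤ L := one_le_sqrt_mul_log (by omega)
    have hL2 : L ^ 2 = n * Real.log n := sq_sqrt_mul_log n
    have hn0 : (0 : ℝ) < n := by positivity
    have hlog : 1 / 2 ≤ Real.log n := one_half_le_log_natCast (by omega)
    have hk0 : (0 : ℝ) < k := (Real.sqrt_pos.2 hn0).trans_le hsq
    have hkL : (k : ℝ) ≤ (C + 1) * L := by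
      have := (Nat.ceil_lt_add_one (a := C * L) (by positivity)).le
      linarith
    have h1 : 1 / 2 * Real.log n ≤ Real.log k := by
      have := Real.log_le_log (Real.sqrt_pos.2 hn0) hsq
      rw [Real.log_sqrt hn0.le] at this
      linarith
    -- With `L² = n log n`, the left side is `(log n / L)²`, while `k ≤ (C+1) L` and `log k ≥ (log
    -- n) / 2`.
    have h2 : Real.log n / n ≤ 4 * (C + 1) ^ 2 * (Real.log k / k) ^ 2 := by
      rw [div_pow, ← mul_div_assoc, div_le_div_iff₀ hn0 (by positivity)]
      calc Real.log n * k ^ 2 ≤ Real.log n * ((C + 1) * L) ^ 2 := by gcongr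
        _ = 4 * (C + 1) ^ 2 * (1 / 2 * Real.log n) ^ 2 * n := by rw [mul_pow, hL2]; ring
        _ ≤ _ := by gcongr
    calc _ = C * Y.complexity k * (Real.log n / n) := by ring
      _ ≤ C * Y.complexity k * (4 * (C + 1) ^ 2 * (Real.log k / k) ^ 2) := by gcongr
      _ = _ := by ring

end SymbolicDynamics.FullShift.Subshift

theorem theorem2 {A : Type*} [Finite A] [TopologicalSpace A] [DiscreteTopology A]
    (Y : SymbolicDynamics.FullShift.Subshift A ℤ)
    (hper : ∀ x : Y.carrier, x ∈ Function.periodicPts Y.shiftHomeo → ¬ IsOpen {x})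
    (hρ : Tendsto (fun n : ℕ => (Real.log n / n) ^ 2 * (Y.complexity n : ℝ)) atTop (𝓝 0))
    (μ : PMF Y.shiftHomeo.topologicalFullGroup)
    (hfin : μ.support.Finite)
    (hsymm : ∀ g, μ g⁻¹ = μ g) :
    μ.HasRandomWalkEntropy 0 ∧
    ∃ C : ℝ, 0 < C ∧ ∀ n : ℕ, 2 ≤ n →
      (μ.convPow n).entropy ≤
        ENNReal.ofReal (C * (Y.complexity ⌈C * Real.sqrt (n * Real.log n)⌉₊ : ℝ) * Real.log n) := by
  obtain ⟨C, hC, hbound⟩ := Y.exists_entropy_convPow_le_complexity hper hρ μ hfin hsymm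
  refine ⟨?_, C, by linarith, hbound⟩
  have hlim := ENNReal.tendsto_ofReal (Y.tendsto_complexity_mul_log_div hρ hC)
  rw [ENNReal.ofReal_zero] at hlim
  refine tendsto_of_tendsto_of_tendsto_of_le_of_le' tendsto_const_nhds hlim
    (Eventually.of_forall fun _ => zero_le) ?_
  filter_upwards [eventually_ge_atTop 2] with n hn
  rw [ENNReal.ofReal_div_of_pos (by positivity), ENNReal.ofReal_natCast]
  exact ENNReal.div_le_div_right (hbound n hn) _
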